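/- Let $q_0,q_1$ be probability measures on a measurable space $\mathcal X$ and let $r_\theta:\mathcal X\to(0,\infty)$ be a measurable function with $\mathbb E_{q_0}[r_\theta]<\infty$ and $\mathbb E_{q_1}[|\log r_\theta|]<\infty$. For an integer $K\ge 1$ and $\nu\ge 0$ put $$\mathcal L_{K;\nu}(\theta)=-\frac{K}{K+\nu}\,\mathbb E_{q_1(x_1)q_0(x_2)\cdots q_0(x_K)}\Bigl[\log\frac{r_\theta(x_1)}{\nu+\sum_{i=1}^K r_\theta(x_i)}\Bigr]-\frac{\nu}{K+\nu}\,\mathbb E_{q_0(x_1)\cdots q_0(x_K)}\Bigl[\log\frac{\nu}{\nu+\sum_{i=1}^K r_\theta(x_i)}\Bigr],$$ where the second term is $0$ when $\nu=0$; under the assumptions above all these expectations are finite. Let $\nu=\nu_K\ge 0$ depend on $K$ in such a way that $\nu_K/K\to\beta$ as $K\to\infty$ for some $\beta\ge 0$. Then, with $0\log 0=0$ and the natural logarithm, $$\lim_{K\to\infty}\Bigl(-\mathcal L_{K;\nu_K}(\theta)+\frac{K\log K}{K+\nu_K}\Bigr)=\frac{\beta}{\beta+1}\log\beta+\frac{1}{\beta+1}\mathbb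 E_{q_1}[\log r_\theta]-\log\bigl(\beta+\mathbb E_{q_0}[r_\theta]\bigr)$$ $$\le\frac{\beta}{\beta+1}\log\beta+\frac{1}{\beta+1}D(q_1\|q_0)-\log(\beta+1),$$ where $D(q_1\|q_0)\in[0,\infty]$ is the Kullback–Leibler divergence. Moreover, suppose that $q_1$ is absolutely continuous with respect to $q_0$, with density ratio $\frac{q_1}{q_0}=\frac{dq_1}{dq_0}$. If $\beta>0$, equality holds in the inequality if and only if $r_\theta=\frac{q_1}{q_0}$ $q_0$-almost everywhere. If $\beta=0$, equality holds if and only if there is a constant $C>0$ with $r_\theta=C\,\frac{q_1}{q_0}$ $q_0$-almost everywhere. -/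

import Mathlib

open MeasureTheory Filter Topology

noncomputable section

namespace InfoNCEAnchor

variable {X : Type*} [MeasurableSpace X]

/-- The law `q₁(x₁) q₀(x₂) ⋯ q₀(x_K)` of one positive example `x.1 = x₁` together with the
`K - 1` negative examples `x.2 = (x₂, …, x_K)`; meaningful for `1 ≤ K`. -/
def positiveLaw (q₀ q₁ : Measure X) (K : ℕ) : Measure (X × (Fin (K - 1) → X)) :=
  q₁.prod (Measure.pi fun _ : Fin (K - 1) => q₀)

/-- The law `q₀(x₁) q₀(x₂) ⋯ q₀(x_K)` of the anchor class. -/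
def anchorLaw (q₀ : Measure X) (K : ℕ) : Measure (Fin K → X) :=
  Measure.pi fun _ : Fin K => q₀

/-- The logarithm `log (r(x₁) / (ν + ∑_{i=1}^K r(x_i)))` of the model posterior probability of
class `1`. -/
def logPosterior (r : X → ℝ) (K : ℕ) (ν : ℝ) (x : X × (Fin (K - 1) → X)) : ℝ :=
  Real.log (r x.1 / (ν + (r x.1 + ∑ i, r (x.2 i))))

/-- The logarithm `log (ν / (ν + ∑_{i=1}^K r(x_i)))` of the model posterior probability of the
anchor class `0`. For `ν = 0` its value is immaterial: it enters the loss with weight `0`. -/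
def logAnchorPosterior (r : X → ℝ) (K : ℕ) (ν : ℝ) (x : Fin K → X) : ℝ :=
  Real.log (ν / (ν + ∑ i, r (x i)))

/-- The InfoNCE-anchor objective `L_{K;ν}` of a density ratio model `r`. -/
def loss (q₀ q₁ : Measure X) (r : X → ℝ) (K : ℕ) (ν : ℝ) : ℝ :=
  -(K / (K + ν)) * ∫ x, logPosterior r K ν x ∂(positiveLaw q₀ q₁ K)
    - ν / (K + ν) * ∫ x, logAnchorPosterior r K ν x ∂(anchorLaw q₀ K)

/-- The generalized Donsker–Varadhan functional
`β/(β+1) log β + 1/(β+1) E_{q₁}[log r] - log (β + E_{q₀}[r])`, with `0 log 0 = 0`. -/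
def limitValue (q₀ q₁ : Measure X) (r : X → ℝ) (β : ℝ) : ℝ :=
  β / (β + 1) * Real.log β + 1 / (β + 1) * ∫ x, Real.log (r x) ∂q₁
    - Real.log (β + ∫ x, r x ∂q₀)

/-- The upper bound `β/(β+1) log β + 1/(β+1) D(q₁‖q₀) - log (β + 1)`, which is `⊤` when the
Kullback–Leibler divergence is infinite. -/
def upperBound (q₀ q₁ : Measure X) (β : ℝ) : EReal :=
  ((β / (β + 1) * Real.log β : ℝ) : EReal)
    + ((1 / (β + 1) : ℝ) : EReal) * (InformationTheory.klDiv q₁ q₀ : EReal)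
    - ((Real.log (β + 1) : ℝ) : EReal)

end InfoNCEAnchor

end

/-! Write `m = ∫ r dq₀`. Dividing inside the logarithms by `K` turns `-L + K log K / (K + ν)` into
an exact expression (`neg_loss_add_eq`) in `E_{q₁}[log r]`, `ν/K` and the means of `log (ν/K + (∑ r)
/ K)` under the two laws. Both empirical means tend to `m`, so the limit follows once the logarithm
and the expectation may be exchanged with the limit.

Upper bounds come from the tangent line of `log` (Jensen). The positive example is split off
beforehand, since only `log r`, not `r`, is `q₁`-integrable. Lower bounds come from a weak law:
nonnegative summands can be truncated without enlarging the sum, so Chebyshev bounds the probability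
of a small empirical mean by `O(1/K)`. On that event the logarithm is at least `log r(x₁) - log K`
in the positive term, a loss of order `log K / K`; in the anchor term it is at least `log (ν/K)`,
tamed by the weight `ν/K`.

The bound adds two inequalities: Donsker–Varadhan, which is nonnegativity of the divergence of `q₁`
from `q₀` tilted by `log r`, and concavity of `log` between `1` and `m`. Equality in the first means
`r = m dq₁/dq₀`; equality in the second forces `m = 1` if `β > 0` and is automatic if `β = 0`. -/

namespace InfoNCEAnchor

/-! ### The Donsker–Varadhan inequality and its equality case. -/

section DonskerVaradhan

variable {X : Type*} [MeasurableSpace X] {q₀ q₁ : Measure X} {r : X → ℝ}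

theorem integrable_exp_log (hr_pos : ∀ x, 0 < r x) (hr_int : Integrable r q₀) :
    Integrable (fun x => Real.exp (Real.log (r x))) q₀ := by
  simpa only [Real.exp_log (hr_pos _)] using hr_int

variable [IsProbabilityMeasure q₀] [IsProbabilityMeasure q₁]

theorem integral_pos_of_forall_pos (hr_pos : ∀ x, 0 < r x) (hr_int : Integrable r q₀) :
    0 < ∫ x, r x ∂q₀ := by
  rw [integral_pos_iff_support_of_nonneg (fun x => (hr_pos x).le) hr_int]
  have : Function.support r = Set.univ := by
    ext x; simp [(hr_pos x).ne']
  simp [this]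

/-- Tilting the reference measure by `log r` shifts the divergence by the Donsker–Varadhan
functional. -/
theorem toReal_klDiv_tilted_log (hr_pos : ∀ x, 0 < r x) (hr_int : Integrable r q₀)
    (hlog_int : Integrable (fun x => Real.log (r x)) q₁) (hac : q₁ ≪ q₀)
    (hllr : Integrable (llr q₁ q₀) q₁) :
    (InformationTheory.klDiv q₁ (q₀.tilted fun x => Real.log (r x))).toReal
      = (InformationTheory.klDiv q₁ q₀).toReal - ∫ x, Real.log (r x) ∂q₁
        + Real.log (∫ x, r x ∂q₀) := by
  have hexp := integrable_exp_log hr_pos hr_int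
  have : IsProbabilityMeasure (q₀.tilted fun x => Real.log (r x)) :=
    isProbabilityMeasure_tilted hexp
  rw [InformationTheory.toReal_klDiv_of_measure_eq
      (hac.trans (absolutelyContinuous_tilted hexp)) (by simp),
    InformationTheory.toReal_klDiv_of_measure_eq hac (by simp),
    integral_llr_tilted_right hac hlog_int hexp hllr]
  simp only [Real.exp_log (hr_pos _)]

/-- The **Donsker–Varadhan inequality**. -/
theorem integral_log_sub_log_integral_le (hr_pos : ∀ x, 0 < r x) (hr_int : Integrable r q₀)
    (hlog_int : Integrable (fun x => Real.log (r x)) q₁) (hac : q₁ ≪ q₀)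
    (hllr : Integrable (llr q₁ q₀) q₁) :
    ∫ x, Real.log (r x) ∂q₁ - Real.log (∫ x, r x ∂q₀)
      ≤ (InformationTheory.klDiv q₁ q₀).toReal := by
  have h := toReal_klDiv_tilted_log hr_pos hr_int hlog_int hac hllr
  have := ENNReal.toReal_nonneg
    (a := InformationTheory.klDiv q₁ (q₀.tilted fun x => Real.log (r x)))
  linarith

/-- Equality in the Donsker–Varadhan inequality forces `r` to be proportional to the density. -/
theorem ae_eq_mul_rnDeriv_of_eq (hr_pos : ∀ x, 0 < r x)
    (hr_int : Integrable r q₀) (hlog_int : Integrable (fun x => Real.log (r x)) q₁)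
    (hac : q₁ ≪ q₀) (hllr : Integrable (llr q₁ q₀) q₁)
    (heq : ∫ x, Real.log (r x) ∂q₁ - Real.log (∫ x, r x ∂q₀)
      = (InformationTheory.klDiv q₁ q₀).toReal) :
    ∀ᵐ x ∂q₀, r x = (∫ x, r x ∂q₀) * (q₁.rnDeriv q₀ x).toReal := by
  have hm := integral_pos_of_forall_pos hr_pos hr_int
  have hexp := integrable_exp_log hr_pos hr_int
  have : IsProbabilityMeasure (q₀.tilted fun x => Real.log (r x)) :=
    isProbabilityMeasure_tilted hexp
  have h := toReal_klDiv_tilted_log hr_pos hr_int hlog_int hac hllr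
  have h0 : InformationTheory.klDiv q₁ (q₀.tilted fun x => Real.log (r x)) = 0 := by
    -- Finiteness matters: `toReal` also sends `⊤` to `0`.
    have hne := InformationTheory.klDiv_ne_top (hac.trans (absolutelyContinuous_tilted hexp))
      (integrable_llr_tilted_right hac hlog_int hllr hexp)
    rw [← ENNReal.toReal_eq_toReal_iff' hne (by simp), h, ENNReal.toReal_zero]
    linarith
  rw [InformationTheory.klDiv_eq_zero_iff] at h0
  have h1 : q₁.rnDeriv q₀ =ᵐ[q₀] fun x => ENNReal.ofReal (r x / ∫ x, r x ∂q₀) := by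
    conv_lhs => rw [h0]
    rw [Measure.tilted]
    refine (Measure.rnDeriv_withDensity₀ q₀ ?_).trans ?_
    · simp only [Real.exp_log (hr_pos _)]
      exact (hr_int.aemeasurable.div_const _).ennreal_ofReal
    · simp only [Real.exp_log (hr_pos _)]; rfl
  filter_upwards [h1] with x hx
  rw [hx, ENNReal.toReal_ofReal (div_nonneg (hr_pos x).le hm.le)]
  field_simp

/-- A ratio model proportional to the density attains the Donsker–Varadhan inequality. -/
theorem klDiv_of_ae_eq_mul_rnDeriv (hlog_int : Integrable (fun x => Real.log (r x)) q₁)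
    (hac : q₁ ≪ q₀) {C : ℝ} (hC : 0 < C)
    (h : ∀ᵐ x ∂q₀, r x = C * (q₁.rnDeriv q₀ x).toReal) :
    Integrable (llr q₁ q₀) q₁ ∧ ∫ x, r x ∂q₀ = C ∧
      ∫ x, Real.log (r x) ∂q₁ - Real.log C = (InformationTheory.klDiv q₁ q₀).toReal := by
  have hae : llr q₁ q₀ =ᵐ[q₁] fun x => Real.log (r x) - Real.log C := by
    filter_upwards [hac.ae_le h, Measure.rnDeriv_pos hac,
      hac.ae_le (Measure.rnDeriv_ne_top q₁ q₀)] with x hx hpos htop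
    rw [hx, Real.log_mul hC.ne' (ENNReal.toReal_pos hpos.ne' htop).ne', llr]
    ring
  refine ⟨?_, ?_, ?_⟩
  · rw [integrable_congr hae]
    exact hlog_int.sub (integrable_const _)
  · rw [integral_congr_ae h, integral_const_mul, Measure.integral_toReal_rnDeriv hac]
    simp
  · rw [InformationTheory.toReal_klDiv_of_measure_eq hac (by simp), integral_congr_ae hae,
      integral_sub hlog_int (integrable_const _)]
    simp

end DonskerVaradhan

/-- Concavity of the logarithm between `1` and `m`. -/
theorem log_div_le_log_add_sub {m β : ℝ} (hm : 0 < m) (hβ : 0 ≤ β) :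
    1 / (β + 1) * Real.log m ≤ Real.log (β + m) - Real.log (β + 1) := by
  have h := strictConcaveOn_log_Ioi.concaveOn.2 (Set.mem_Ioi.2 one_pos) (Set.mem_Ioi.2 hm)
    (by positivity : 0 ≤ β / (β + 1)) (by positivity : 0 ≤ 1 / (β + 1)) (by field_simp)
  simp only [smul_eq_mul, Real.log_one, mul_zero, zero_add] at h
  rw [← Real.log_div (by positivity) (by positivity)]
  exact h.trans_eq (congrArg Real.log (by field_simp))

/-- Strict concavity applies because `β > 0` gives both points `1` and `m` positive weight. At `β =
0` the identity holds for every `m`, which is why a free constant survives there. -/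
theorem eq_one_of_log_div_eq {m β : ℝ} (hm : 0 < m) (hβ : 0 < β)
    (h : 1 / (β + 1) * Real.log m = Real.log (β + m) - Real.log (β + 1)) : m = 1 := by
  by_contra hne
  have h' := strictConcaveOn_log_Ioi.2 (Set.mem_Ioi.2 one_pos) (Set.mem_Ioi.2 hm)
    (Ne.symm hne) (by positivity : 0 < β / (β + 1)) (by positivity : 0 < 1 / (β + 1))
    (by field_simp)
  simp only [smul_eq_mul, Real.log_one, mul_zero, zero_add] at h'
  rw [← Real.log_div (by positivity) (by positivity)] at h
  refine absurd h (ne_of_lt ?_)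
  convert h' using 2
  field_simp

/-! ### The upper bound on the limit and its equality cases. -/

section Bound

variable {X : Type*} [MeasurableSpace X] {q₀ q₁ : Measure X} {r : X → ℝ} {β : ℝ}

theorem upperBound_eq_coe (h : InformationTheory.klDiv q₁ q₀ ≠ ⊤) :
    upperBound q₀ q₁ β = ((β / (β + 1) * Real.log β
      + 1 / (β + 1) * (InformationTheory.klDiv q₁ q₀).toReal - Real.log (β + 1) : ℝ) : EReal) := by
  rw [upperBound, ← EReal.coe_toReal (x := (InformationTheory.klDiv q₁ q₀ : EReal)) (by simpa)
    (by simp)]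
  norm_cast
  rw [EReal.toReal_coe_ennreal]

theorem upperBound_eq_top (hβ : 0 ≤ β) (h : InformationTheory.klDiv q₁ q₀ = ⊤) :
    upperBound q₀ q₁ β = ⊤ := by
  rw [upperBound, h, EReal.coe_ennreal_top, EReal.coe_mul_top_of_pos (by positivity),
    EReal.coe_add_top, EReal.top_sub_coe]

variable [IsProbabilityMeasure q₀] [IsProbabilityMeasure q₁]

theorem limitValue_le_upperBound (hr_pos : ∀ x, 0 < r x) (hr_int : Integrable r q₀)
    (hlog_int : Integrable (fun x => Real.log (r x)) q₁) (hβ : 0 ≤ β) :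
    (limitValue q₀ q₁ r β : EReal) ≤ upperBound q₀ q₁ β := by
  by_cases h : InformationTheory.klDiv q₁ q₀ = ⊤
  · rw [upperBound_eq_top hβ h]; exact le_top
  obtain ⟨hac, hllr⟩ := InformationTheory.klDiv_ne_top_iff.1 h
  rw [upperBound_eq_coe h, EReal.coe_le_coe_iff, limitValue]
  have h1 := mul_le_mul_of_nonneg_left
    (integral_log_sub_log_integral_le hr_pos hr_int hlog_int hac hllr)
    (by positivity : 0 ≤ 1 / (β + 1))
  have h2 := log_div_le_log_add_sub (integral_pos_of_forall_pos hr_pos hr_int) hβ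
  linarith

/-- Equality in the bound means equality in both the Donsker–Varadhan inequality and in the
concavity estimate. -/
theorem eq_of_limitValue_eq_upperBound (hr_pos : ∀ x, 0 < r x)
    (hr_int : Integrable r q₀) (hlog_int : Integrable (fun x => Real.log (r x)) q₁) (hβ : 0 ≤ β)
    (h : (limitValue q₀ q₁ r β : EReal) = upperBound q₀ q₁ β) :
    (∀ᵐ x ∂q₀, r x = (∫ x, r x ∂q₀) * (q₁.rnDeriv q₀ x).toReal) ∧
      1 / (β + 1) * Real.log (∫ x, r x ∂q₀)
        = Real.log (β + ∫ x, r x ∂q₀) - Real.log (β + 1) := by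
  by_cases hk : InformationTheory.klDiv q₁ q₀ = ⊤
  · rw [upperBound_eq_top hβ hk] at h
    exact absurd h (EReal.coe_ne_top _)
  obtain ⟨hac, hllr⟩ := InformationTheory.klDiv_ne_top_iff.1 hk
  rw [upperBound_eq_coe hk, EReal.coe_eq_coe_iff, limitValue] at h
  have hβ1 : 0 < 1 / (β + 1) := by positivity
  have h0 := integral_log_sub_log_integral_le hr_pos hr_int hlog_int hac hllr
  have h1 := mul_le_mul_of_nonneg_left h0 hβ1.le
  have h2 := log_div_le_log_add_sub (integral_pos_of_forall_pos hr_pos hr_int) hβ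
  refine ⟨ae_eq_mul_rnDeriv_of_eq hr_pos hr_int hlog_int hac hllr ?_, by linarith⟩
  exact mul_left_cancel₀ hβ1.ne' (by linarith)

/-- Finiteness of the divergence is automatic: the log-likelihood ratio is `log r - log C`, which is
`q₁`-integrable. The remaining `log C` cancels against `log (β + C)` if `β = 0` and vanishes if `C =
1`. -/
theorem limitValue_eq_upperBound_of_ae_eq (hlog_int : Integrable (fun x => Real.log (r x)) q₁)
    (hac : q₁ ≪ q₀) {C : ℝ} (hC : 0 < C) (hβC : β = 0 ∨ C = 1)
    (h : ∀ᵐ x ∂q₀, r x = C * (q₁.rnDeriv q₀ x).toReal) :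
    (limitValue q₀ q₁ r β : EReal) = upperBound q₀ q₁ β := by
  obtain ⟨hllr, hm, hk⟩ := klDiv_of_ae_eq_mul_rnDeriv hlog_int hac hC h
  rw [upperBound_eq_coe (InformationTheory.klDiv_ne_top hac hllr), ← hk, limitValue, hm]
  rcases hβC with rfl | rfl <;> simp

end Bound

/-! ### A one-sided weak law by truncation and Chebyshev. -/

section WeakLaw

variable {X : Type*} [MeasurableSpace X] {q₀ : Measure X} {r : X → ℝ}

/-- Supplies a truncation level at which the mean still exceeds a given `c < m`, while the variance
becomes finite. -/
theorem tendsto_integral_min (hr_meas : Measurable r) (hr_pos : ∀ x, 0 < r x)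
    (hr_int : Integrable r q₀) :
    Tendsto (fun M : ℕ => ∫ x, min (r x) M ∂q₀) atTop (𝓝 (∫ x, r x ∂q₀)) := by
  refine tendsto_integral_of_dominated_convergence r
    (fun M => (hr_meas.min measurable_const).aestronglyMeasurable) hr_int
    (fun M => ae_of_all _ fun x => ?_) (ae_of_all _ fun x => ?_)
  · rw [Real.norm_of_nonneg (le_min (hr_pos x).le (Nat.cast_nonneg M))]
    exact min_le_left _ _
  · refine tendsto_const_nhds.congr' ?_
    filter_upwards [eventually_ge_atTop ⌈r x⌉₊] with M hM
    exact (min_eq_left ((Nat.le_ceil _).trans (by exact_mod_cast hM))).symm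

variable [IsProbabilityMeasure q₀]

theorem integrable_sum_eval (hr_int : Integrable r q₀) (n : ℕ) :
    Integrable (fun x : Fin n → X => ∑ i, r (x i)) (Measure.pi fun _ : Fin n => q₀) :=
  integrable_finsetSum _ fun _ _ => integrable_comp_eval hr_int

theorem integral_sum_eval (hr_int : Integrable r q₀) (n : ℕ) :
    ∫ x : Fin n → X, ∑ i, r (x i) ∂(Measure.pi fun _ : Fin n => q₀) = n * ∫ x, r x ∂q₀ := by
  rw [integral_finsetSum _ fun _ _ => integrable_comp_eval hr_int]
  simp [integral_comp_eval (μ := fun _ : Fin n => q₀) hr_int.aestronglyMeasurable]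

/-- A one-sided weak law of large numbers with rate `O(1/n)`, for positive summands with finite
mean (and no assumption on the variance). -/
theorem exists_measureReal_sum_lt_le (hr_meas : Measurable r) (hr_pos : ∀ x, 0 < r x)
    (hr_int : Integrable r q₀) {c : ℝ} (hc : c < ∫ x, r x ∂q₀) :
    ∃ C : ℝ, ∀ n : ℕ, (Measure.pi fun _ : Fin n => q₀).real
      {x : Fin n → X | ∑ i, r (x i) < n * c} ≤ C / (n + 1) := by
  obtain ⟨M, hM⟩ := ((tendsto_order.1 (tendsto_integral_min hr_meas hr_pos hr_int)).1 c hc).exists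
  set g : X → ℝ := fun x => min (r x) M
  set δ : ℝ := ∫ x, g x ∂q₀ - c
  have hδ : 0 < δ := sub_pos.2 hM
  have hg_meas : Measurable g := hr_meas.min measurable_const
  have hg_mem : ∀ x, g x ∈ Set.Icc (0 : ℝ) M := fun x =>
    ⟨le_min (hr_pos x).le (Nat.cast_nonneg M), min_le_right _ _⟩
  have hg_int : Integrable g q₀ := hr_int.mono hg_meas.aestronglyMeasurable <|
      ae_of_all _ fun x => by
    rw [Real.norm_of_nonneg (hg_mem x).1, Real.norm_of_nonneg (hr_pos x).le]
    exact min_le_left _ _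
  have hg_lp : MemLp g 2 q₀ := memLp_of_bounded (ae_of_all _ hg_mem)
    hg_meas.aestronglyMeasurable 2
  have hvar := ProbabilityTheory.variance_le_sq_of_bounded (ae_of_all q₀ hg_mem)
    hg_meas.aemeasurable
  set V := ((M - 0 : ℝ) / 2) ^ 2
  -- Chebyshev gives `V / (δ² n)`; the factor `2` converts `1 / n` to `1 / (n + 1)` for `n ≥ 1`. For
  -- `n = 0` the event is empty.
  refine ⟨max 1 (2 * V / δ ^ 2), fun n => ?_⟩
  rcases Nat.eq_zero_or_pos n with rfl | hn
  · simp
  have hn' : (1 : ℝ) ≤ n := by exact_mod_cast hn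
  set P := Measure.pi fun _ : Fin n => q₀
  have hS_lp : MemLp (∑ i : Fin n, fun x : Fin n → X => g (x i)) 2 P :=
    memLp_finsetSum' _ fun i _ => hg_lp.comp_measurePreserving
      (measurePreserving_eval (fun _ : Fin n => q₀) i)
  have hS_mean : ∫ x, (∑ i : Fin n, fun x : Fin n → X => g (x i)) x ∂P = n * ∫ x, g x ∂q₀ := by
    simpa only [Finset.sum_apply] using integral_sum_eval hg_int n
  have hS_var := ProbabilityTheory.variance_sum_pi (μ := fun _ : Fin n => q₀)
    (X := fun _ => g) fun _ => hg_lp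
  have hcheb := ProbabilityTheory.meas_ge_le_variance_div_sq hS_lp (c := n * δ) (by positivity)
  rw [hS_var, hS_mean] at hcheb
  -- Truncation only lowers the sum, so a small sum of `r` forces the sum of `g` at least `n * δ`
  -- below its mean.
  have hsub : {x : Fin n → X | ∑ i, r (x i) < n * c} ⊆
      {x | n * δ ≤ |(∑ i : Fin n, fun x : Fin n → X => g (x i)) x - n * ∫ x, g x ∂q₀|} := by
    intro x hx
    simp only [Set.mem_ofPred_eq, Finset.sum_apply] at hx ⊢
    have h1 : ∑ i, g (x i) ≤ ∑ i, r (x i) := Finset.sum_le_sum fun i _ => min_le_left _ _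
    rw [abs_sub_comm]
    refine le_trans ?_ (le_abs_self _)
    simp only [δ, mul_sub]
    linarith
  have hle := ENNReal.toReal_mono ENNReal.ofReal_ne_top ((measure_mono hsub).trans hcheb)
  rw [ENNReal.toReal_ofReal (div_nonneg
    (Finset.sum_nonneg fun _ _ => ProbabilityTheory.variance_nonneg _ _) (sq_nonneg _))] at hle
  refine hle.trans ?_
  simp only [Finset.sum_const, Finset.card_univ, Fintype.card_fin, nsmul_eq_mul]
  calc n * ProbabilityTheory.variance g q₀ / (n * δ) ^ 2 ≤ n * V / (n * δ) ^ 2 := by gcongr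
    _ = V / δ ^ 2 / n := by field_simp
    _ ≤ 2 * V / δ ^ 2 / (n + 1) := by
      rw [div_le_div_iff₀ (by positivity) (by positivity), mul_div_assoc]
      have : 0 ≤ V / δ ^ 2 := by positivity
      nlinarith
    _ ≤ _ := by gcongr; exact le_max_right _ _

end WeakLaw

/-! ### Elementary bounds on the logarithm. -/

theorem log_one_add_le {t : ℝ} (ht : 0 < t) : Real.log (1 + t) ≤ Real.log 2 + |Real.log t| := by
  rcases le_total t 1 with h | h
  · have := Real.log_le_log (by linarith : 0 < 1 + t) (by linarith : 1 + t ≤ 2)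
    linarith [abs_nonneg (Real.log t)]
  · have := Real.log_le_log (by linarith : 0 < 1 + t) (by linarith : 1 + t ≤ 2 * t)
    rw [Real.log_mul two_ne_zero ht.ne'] at this
    linarith [le_abs_self (Real.log t)]

/-- Follows from `z + w ≤ (z + η) * (1 + w / η)`. It isolates a summand `w` that has an integrable
logarithm but possibly no mean. -/
theorem log_add_le_log_add_log {z w η : ℝ} (hz : 0 ≤ z) (hw : 0 < w) (hη : 0 < η) :
    Real.log (z + w) ≤ Real.log (z + η) + Real.log (1 + w / η) := by
  rw [← Real.log_mul (by positivity) (by positivity)]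
  refine Real.log_le_log (by positivity) ?_
  have : (z + η) * (1 + w / η) = z + w + (η + z * (w / η)) := by field_simp; ring
  have : 0 ≤ η + z * (w / η) := by positivity
  linarith

/-- The tangent line at `z₀`; integrated with `z₀` the mean of `z`, it gives Jensen's inequality. -/
theorem log_le_log_add_div {z z₀ : ℝ} (hz : 0 < z) (hz₀ : 0 < z₀) :
    Real.log z ≤ Real.log z₀ + (z - z₀) / z₀ := by
  have := Real.log_le_sub_one_of_pos (div_pos hz hz₀)
  rw [Real.log_div hz.ne' hz₀.ne'] at this
  rw [sub_div, div_self hz₀.ne']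
  linarith

/-! ### Integrability and two-sided bounds for a fixed number of samples. -/

section Estimates

variable {X : Type*} {r : X → ℝ}

theorem sum_eval_nonneg (hr_pos : ∀ x, 0 < r x) {n : ℕ} (x : Fin n → X) : 0 ≤ ∑ i, r (x i) :=
  Finset.sum_nonneg fun _ _ => (hr_pos _).le

variable [MeasurableSpace X] {q₀ q₁ : Measure X} [IsProbabilityMeasure q₀] [IsProbabilityMeasure q₁]

/-- The positive example bounds the logarithm below by `log r(x₁)`, so `v = 0` is allowed. Above,
the negatives contribute at most linearly and the positive example only logarithmically. -/
theorem integrable_log_prod (hr_meas : Measurable r) (hr_pos : ∀ x, 0 < r x)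
    (hr_int : Integrable r q₀) (hlog_int : Integrable (fun x => Real.log (r x)) q₁) (n : ℕ)
    {v : ℝ} (hv : 0 ≤ v) :
    Integrable (fun x : X × (Fin n → X) => Real.log (v + (r x.1 + ∑ i, r (x.2 i))))
      (q₁.prod (Measure.pi fun _ : Fin n => q₀)) := by
  have h1 : Integrable (fun x : X × (Fin n → X) => |Real.log (r x.1)|)
      (q₁.prod (Measure.pi fun _ : Fin n => q₀)) := hlog_int.abs.comp_fst _
  have h2 : Integrable (fun x : X × (Fin n → X) => ∑ i, r (x.2 i))
      (q₁.prod (Measure.pi fun _ : Fin n => q₀)) := (integrable_sum_eval hr_int n).comp_snd q₁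
  refine ((h1.add h2).add (integrable_const (Real.log 2 + v))).mono'
    (Measurable.log (by fun_prop)).aestronglyMeasurable (ae_of_all _ fun x => ?_)
  have hT := sum_eval_nonneg hr_pos x.2
  have hr := hr_pos x.1
  have hlow : Real.log (r x.1) ≤ Real.log (v + (r x.1 + ∑ i, r (x.2 i))) :=
    Real.log_le_log hr (by linarith)
  have hup := log_add_le_log_add_log (add_nonneg hv hT) hr one_pos
  rw [div_one, show v + ∑ i, r (x.2 i) + r x.1 = v + (r x.1 + ∑ i, r (x.2 i)) by ring] at hup
  have h3 := Real.log_le_sub_one_of_pos (by positivity : 0 < v + ∑ i, r (x.2 i) + 1)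
  have h4 := log_one_add_le hr
  have h5 : 0 ≤ Real.log 2 := Real.log_nonneg one_le_two
  simp only [Pi.add_apply, Real.norm_eq_abs]
  rw [abs_le]
  constructor
  · linarith [neg_abs_le (Real.log (r x.1))]
  · linarith

/-- Here `v > 0` supplies the lower bound, since `log r` need not be integrable under `q₀`. -/
theorem integrable_log_pi (hr_meas : Measurable r) (hr_pos : ∀ x, 0 < r x)
    (hr_int : Integrable r q₀) (n : ℕ) {v : ℝ} (hv : 0 < v) :
    Integrable (fun x : Fin n → X => Real.log (v + ∑ i, r (x i)))
      (Measure.pi fun _ : Fin n => q₀) := by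
  refine ((integrable_sum_eval hr_int n).add (integrable_const (|Real.log v| + v))).mono'
    (Measurable.log (by fun_prop)).aestronglyMeasurable (ae_of_all _ fun x => ?_)
  have hT := sum_eval_nonneg hr_pos x
  have hlow : Real.log v ≤ Real.log (v + ∑ i, r (x i)) := Real.log_le_log hv (by linarith)
  have hup := Real.log_le_sub_one_of_pos (by positivity : 0 < v + ∑ i, r (x i))
  simp only [Pi.add_apply, Real.norm_eq_abs]
  rw [abs_le]
  constructor
  · linarith [neg_abs_le (Real.log v)]
  · linarith [abs_nonneg (Real.log v)]

theorem log_div_add_div {v s k : ℝ} (hk : 0 < k) (hs : 0 < v + s) :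
    Real.log (v / k + s / k) = Real.log (v + s) - Real.log k := by
  rw [← add_div, Real.log_div hs.ne' hk.ne']

theorem integrable_log_mean_prod (hr_meas : Measurable r) (hr_pos : ∀ x, 0 < r x)
    (hr_int : Integrable r q₀) (hlog_int : Integrable (fun x => Real.log (r x)) q₁) (n : ℕ)
    {v k : ℝ} (hv : 0 ≤ v) (hk : 0 < k) :
    Integrable (fun x : X × (Fin n → X) => Real.log (v / k + (r x.1 + ∑ i, r (x.2 i)) / k))
      (q₁.prod (Measure.pi fun _ : Fin n => q₀)) := by
  refine ((integrable_log_prod hr_meas hr_pos hr_int hlog_int n hv).sub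
    (integrable_const (Real.log k))).congr (ae_of_all _ fun x => ?_)
  have := sum_eval_nonneg hr_pos x.2
  have := hr_pos x.1
  exact (log_div_add_div hk (by positivity)).symm

theorem integrable_log_mean_pi (hr_meas : Measurable r) (hr_pos : ∀ x, 0 < r x)
    (hr_int : Integrable r q₀) (n : ℕ) {v k : ℝ} (hv : 0 < v) (hk : 0 < k) :
    Integrable (fun x : Fin n → X => Real.log (v / k + (∑ i, r (x i)) / k))
      (Measure.pi fun _ : Fin n => q₀) := by
  refine ((integrable_log_pi hr_meas hr_pos hr_int n hv).sub
    (integrable_const (Real.log k))).congr (ae_of_all _ fun x => ?_)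
  have := sum_eval_nonneg hr_pos x
  exact (log_div_add_div hk (by positivity)).symm

theorem integrable_log_one_add (hr_meas : Measurable r) (hr_pos : ∀ x, 0 < r x)
    (hlog_int : Integrable (fun x => Real.log (r x)) q₁) {a : ℝ} (ha : 0 < a) :
    Integrable (fun x => Real.log (1 + r x / a)) q₁ := by
  refine (hlog_int.abs.add (integrable_const (Real.log 2 + |Real.log a|))).mono'
    (Measurable.log (by fun_prop)).aestronglyMeasurable (ae_of_all _ fun x => ?_)
  have hr := hr_pos x
  have hra : 0 < r x / a := div_pos hr ha
  rw [Real.norm_of_nonneg (Real.log_nonneg (by linarith))]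
  have h1 := log_one_add_le hra
  rw [Real.log_div hr.ne' ha.ne'] at h1
  have h2 := norm_sub_le (Real.log (r x)) (Real.log a)
  simp only [Pi.add_apply, Real.norm_eq_abs] at h2 ⊢
  linarith

/-- Upper bound on the positive term; the slack `η` separates off the positive example, which need not
have a finite mean under `q₁`. -/
theorem integral_log_mean_prod_le (hr_meas : Measurable r) (hr_pos : ∀ x, 0 < r x)
    (hr_int : Integrable r q₀) (hlog_int : Integrable (fun x => Real.log (r x)) q₁) (n : ℕ)
    {v k η : ℝ} (hv : 0 ≤ v) (hk : 0 < k) (hη : 0 < η) :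
    ∫ x : X × (Fin n → X), Real.log (v / k + (r x.1 + ∑ i, r (x.2 i)) / k)
        ∂(q₁.prod (Measure.pi fun _ : Fin n => q₀))
      ≤ Real.log (v / k + n / k * (∫ x, r x ∂q₀) + η)
        + ∫ x, Real.log (1 + r x / (k * η)) ∂q₁ := by
  set m := ∫ x, r x ∂q₀ with hm
  have hm0 : 0 ≤ m := integral_nonneg fun x => (hr_pos x).le
  -- The tangent point is the mean of `v / k + (∑ r) / k + η` over the negatives, so the linear term
  -- integrates to `0`.
  set z₀ := v / k + n / k * m + η
  have hz₀ : 0 < z₀ := by positivity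
  have hTint : Integrable (fun y : Fin n → X => ((∑ i, r (y i)) - n * m) / (k * z₀))
      (Measure.pi fun _ : Fin n => q₀) :=
    ((integrable_sum_eval hr_int n).sub (integrable_const (n * m))).div_const (k * z₀)
  have hT0 : ∫ y : Fin n → X, ((∑ i, r (y i)) - n * m) / (k * z₀)
      ∂(Measure.pi fun _ : Fin n => q₀) = 0 := by
    rw [integral_div, integral_sub (integrable_sum_eval hr_int n) (integrable_const _),
      integral_sum_eval hr_int n]
    simp [hm]
  have hlog := integrable_log_one_add hr_meas hr_pos hlog_int (mul_pos hk hη)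
  have hI1 : Integrable (fun x : X × (Fin n → X) =>
      ((∑ i, r (x.2 i)) - n * m) / (k * z₀) + Real.log z₀)
      (q₁.prod (Measure.pi fun _ : Fin n => q₀)) :=
    (hTint.comp_snd q₁).add (integrable_const (Real.log z₀))
  have hI2 := hlog.comp_fst (Measure.pi fun _ : Fin n => q₀)
  calc _ ≤ ∫ x : X × (Fin n → X), ((((∑ i, r (x.2 i)) - n * m) / (k * z₀) + Real.log z₀)
        + Real.log (1 + r x.1 / (k * η))) ∂(q₁.prod (Measure.pi fun _ : Fin n => q₀)) := by
        refine integral_mono (integrable_log_mean_prod hr_meas hr_pos hr_int hlog_int n hv hk)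
          (hI1.add hI2) fun x => ?_
        have hT := sum_eval_nonneg hr_pos x.2
        have hr := hr_pos x.1
        have h1 := log_add_le_log_add_log (z := v / k + (∑ i, r (x.2 i)) / k) (w := r x.1 / k)
          (by positivity) (by positivity) hη
        have h2 := log_le_log_add_div (z := v / k + (∑ i, r (x.2 i)) / k + η)
          (by positivity) hz₀
        rw [show v / k + (∑ i, r (x.2 i)) / k + η - z₀ = ((∑ i, r (x.2 i)) - n * m) / k by
          simp only [z₀]; ring, div_div] at h2
        rw [div_div, show v / k + (∑ i, r (x.2 i)) / k + r x.1 / k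
          = v / k + (r x.1 + ∑ i, r (x.2 i)) / k by ring] at h1
        linarith
    _ = _ := by
        rw [integral_add hI1 hI2, integral_add (hTint.comp_snd q₁) (integrable_const _),
          integral_fun_snd (fun y : Fin n → X => ((∑ i, r (y i)) - n * m) / (k * z₀)),
          integral_fun_fst (fun x => Real.log (1 + r x / (k * η))), hT0]
        simp

/-- Jensen's inequality for the anchor term. -/
theorem integral_log_mean_pi_le (hr_meas : Measurable r) (hr_pos : ∀ x, 0 < r x)
    (hr_int : Integrable r q₀) {n : ℕ} (hn : 0 < n) {v : ℝ} (hv : 0 < v) :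
    ∫ x : Fin n → X, Real.log (v / n + (∑ i, r (x i)) / n) ∂(Measure.pi fun _ : Fin n => q₀)
      ≤ Real.log (v / n + ∫ x, r x ∂q₀) := by
  set m := ∫ x, r x ∂q₀ with hm
  have hm0 : 0 ≤ m := integral_nonneg fun x => (hr_pos x).le
  have hk : (0 : ℝ) < n := by exact_mod_cast hn
  set z₀ := v / n + m
  have hz₀ : 0 < z₀ := by positivity
  have hTint : Integrable (fun y : Fin n → X => ((∑ i, r (y i)) - n * m) / (n * z₀))
      (Measure.pi fun _ : Fin n => q₀) :=
    ((integrable_sum_eval hr_int n).sub (integrable_const (n * m))).div_const (n * z₀)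
  calc _ ≤ ∫ x : Fin n → X, (((∑ i, r (x i)) - n * m) / (n * z₀) + Real.log z₀)
        ∂(Measure.pi fun _ : Fin n => q₀) := by
        refine integral_mono (integrable_log_mean_pi hr_meas hr_pos hr_int n hv hk)
          (hTint.add (integrable_const _)) fun x => ?_
        have hT := sum_eval_nonneg hr_pos x
        have h2 := log_le_log_add_div (z := v / n + (∑ i, r (x i)) / n) (by positivity) hz₀
        rw [show v / n + (∑ i, r (x i)) / n - z₀ = ((∑ i, r (x i)) - n * m) / n by
          simp only [z₀]; field_simp; ring, div_div] at h2
        linarith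
    _ = _ := by
        rw [integral_add hTint (integrable_const _)]
        rw [integral_div, integral_sub (integrable_sum_eval hr_int n) (integrable_const _),
          integral_sum_eval hr_int n]
        simp [hm]

theorem measurableSet_sum_lt (hr_meas : Measurable r) (n : ℕ) (c : ℝ) :
    MeasurableSet {x : Fin n → X | ∑ i, r (x i) < n * c} :=
  measurableSet_lt (by fun_prop) measurable_const

/-- Lower bound on the positive term: when the empirical mean of the negatives is small, the positive
example alone controls the logarithm. -/
theorem le_integral_log_mean_prod (hr_meas : Measurable r) (hr_pos : ∀ x, 0 < r x)
    (hr_int : Integrable r q₀) (hlog_int : Integrable (fun x => Real.log (r x)) q₁) {n : ℕ}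
    (hn : 0 < n) {v k c : ℝ} (hv : 0 ≤ v) (hk : 0 < k) (hc : 0 < c) :
    (1 - (Measure.pi fun _ : Fin n => q₀).real {x : Fin n → X | ∑ i, r (x i) < n * c})
          * Real.log (v / k + n / k * c)
        + (Measure.pi fun _ : Fin n => q₀).real {x : Fin n → X | ∑ i, r (x i) < n * c}
          * (∫ x, Real.log (r x) ∂q₁ - Real.log k)
      ≤ ∫ x : X × (Fin n → X), Real.log (v / k + (r x.1 + ∑ i, r (x.2 i)) / k)
        ∂(q₁.prod (Measure.pi fun _ : Fin n => q₀)) := by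
  set P := Measure.pi fun _ : Fin n => q₀
  set G := {x : Fin n → X | ∑ i, r (x i) < n * c}
  have hG : MeasurableSet G := measurableSet_sum_lt hr_meas n c
  have hGint : Integrable (G.indicator fun _ => (1 : ℝ)) P := (integrable_const _).indicator hG
  have hGval : ∫ y, G.indicator (fun _ => (1 : ℝ)) y ∂P = P.real G := integral_indicator_one hG
  have hn' : (0 : ℝ) < n := by exact_mod_cast hn
  set l := Real.log (v / k + n / k * c)
  have hI1 : Integrable (fun y => (1 - G.indicator (fun _ => (1 : ℝ)) y) * l) P :=
    ((integrable_const _).sub hGint).mul_const l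
  have hI2 : Integrable (fun x => Real.log (r x) - Real.log k) q₁ :=
    hlog_int.sub (integrable_const _)
  -- The integrand is `l` off `G` and `log (r(x₁) / k)` on `G`; as `G` concerns only the negatives,
  -- independence factors its integral.
  calc _ = ∫ x : X × (Fin n → X), ((1 - G.indicator (fun _ => (1 : ℝ)) x.2) * l
        + (Real.log (r x.1) - Real.log k) * G.indicator (fun _ => (1 : ℝ)) x.2) ∂(q₁.prod P) := by
        rw [integral_add (hI1.comp_snd q₁) (hI2.mul_prod hGint),
          integral_prod_mul (fun x => Real.log (r x) - Real.log k)
            (fun y => G.indicator (fun _ => (1 : ℝ)) y),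
          integral_fun_snd (fun y => (1 - G.indicator (fun _ => (1 : ℝ)) y) * l),
          integral_mul_const, integral_sub (integrable_const _) hGint, hGval,
          integral_sub hlog_int (integrable_const _)]
        simp
        ring
    _ ≤ _ := by
        refine integral_mono ((hI1.comp_snd q₁).add (hI2.mul_prod hGint))
          (integrable_log_mean_prod hr_meas hr_pos hr_int hlog_int n hv hk) fun x => ?_
        have hT := sum_eval_nonneg hr_pos x.2
        have hr := hr_pos x.1
        by_cases hx : x.2 ∈ G
        · simp only [Set.indicator_of_mem hx]
          rw [← Real.log_div hr.ne' hk.ne']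
          simp only [sub_self, zero_mul, zero_add, mul_one]
          refine Real.log_le_log (by positivity) ?_
          have : 0 ≤ v / k + (∑ i, r (x.2 i)) / k := by positivity
          rw [add_div]
          linarith
        · simp only [Set.indicator_of_notMem hx]
          simp only [sub_zero, one_mul, mul_zero, add_zero]
          refine Real.log_le_log (by positivity) ?_
          have hx' : n * c ≤ ∑ i, r (x.2 i) := not_lt.1 hx
          have : n / k * c ≤ (r x.1 + ∑ i, r (x.2 i)) / k := by
            rw [div_mul_eq_mul_div]
            gcongr
            linarith
          linarith

/-- Lower bound on the anchor term, where `v / n` alone controls the logarithm in the exceptional event. -/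
theorem le_integral_log_mean_pi (hr_meas : Measurable r) (hr_pos : ∀ x, 0 < r x)
    (hr_int : Integrable r q₀) {n : ℕ} (hn : 0 < n) {v c : ℝ} (hv : 0 < v) (hc : 0 < c) :
    (1 - (Measure.pi fun _ : Fin n => q₀).real {x : Fin n → X | ∑ i, r (x i) < n * c})
          * Real.log (v / n + c)
        + (Measure.pi fun _ : Fin n => q₀).real {x : Fin n → X | ∑ i, r (x i) < n * c}
          * Real.log (v / n)
      ≤ ∫ x : Fin n → X, Real.log (v / n + (∑ i, r (x i)) / n)
        ∂(Measure.pi fun _ : Fin n => q₀) := by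
  set P := Measure.pi fun _ : Fin n => q₀
  set G := {x : Fin n → X | ∑ i, r (x i) < n * c}
  have hG : MeasurableSet G := measurableSet_sum_lt hr_meas n c
  have hGint : Integrable (G.indicator fun _ => (1 : ℝ)) P := (integrable_const _).indicator hG
  have hGval : ∫ y, G.indicator (fun _ => (1 : ℝ)) y ∂P = P.real G := integral_indicator_one hG
  have hn' : (0 : ℝ) < n := by exact_mod_cast hn
  have hI1 : Integrable
      (fun x => (1 - G.indicator (fun _ => (1 : ℝ)) x) * Real.log (v / n + c)) P :=
    ((integrable_const (1 : ℝ)).sub hGint).mul_const (Real.log (v / n + c))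
  have hI2 := hGint.mul_const (Real.log (v / n))
  calc _ = ∫ x : Fin n → X, ((1 - G.indicator (fun _ => (1 : ℝ)) x) * Real.log (v / n + c)
        + G.indicator (fun _ => (1 : ℝ)) x * Real.log (v / n)) ∂P := by
        rw [integral_add hI1 hI2, integral_mul_const, integral_mul_const,
          integral_sub (integrable_const _) hGint, hGval]
        simp
    _ ≤ _ := by
        refine integral_mono (hI1.add hI2)
          (integrable_log_mean_pi hr_meas hr_pos hr_int n hv hn') fun x => ?_
        have hT := sum_eval_nonneg hr_pos x
        by_cases hx : x ∈ G
        · simp only [Set.indicator_of_mem hx]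
          simp only [sub_self, zero_mul, zero_add, one_mul]
          refine Real.log_le_log (by positivity) ?_
          linarith [div_nonneg hT hn'.le]
        · simp only [Set.indicator_of_notMem hx]
          simp only [sub_zero, one_mul, zero_mul, add_zero]
          refine Real.log_le_log (by positivity) ?_
          have hx' : n * c ≤ ∑ i, r (x i) := not_lt.1 hx
          have : c ≤ (∑ i, r (x i)) / n := by
            rw [le_div_iff₀ hn']
            linarith
          linarith

end Estimates

/-! ### Null sequences. -/

theorem tendsto_log_div_natCast :
    Tendsto (fun K : ℕ => Real.log (K : ℝ) / (K : ℝ)) atTop (𝓝 0) :=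
  (Real.isLittleO_log_id_atTop.tendsto_div_nhds_zero).comp tendsto_natCast_atTop_atTop

theorem tendsto_natCast_sub_one_div :
    Tendsto (fun K : ℕ => ((K - 1 : ℕ) : ℝ) / (K : ℝ)) atTop (𝓝 1) := by
  have h : Tendsto (fun K : ℕ => 1 - 1 / (K : ℝ)) atTop (𝓝 (1 - 0)) :=
    tendsto_const_nhds.sub tendsto_one_div_atTop_nhds_zero_nat
  rw [sub_zero] at h
  refine h.congr' ?_
  filter_upwards [eventually_ge_atTop 1] with K hK
  have : (0 : ℝ) < K := by exact_mod_cast hK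
  rw [Nat.cast_sub hK, sub_div, div_self this.ne', Nat.cast_one]

/-- A rate `O(1/n)` is enough to absorb a logarithm. -/
theorem tendsto_zero_of_le_div_add_one {p : ℕ → ℝ} {C : ℝ} (hp0 : ∀ n, 0 ≤ p n)
    (hp : ∀ n : ℕ, p n ≤ C / (n + 1)) :
    Tendsto p atTop (𝓝 0) ∧ Tendsto (fun K : ℕ => p (K - 1)) atTop (𝓝 0) ∧
      Tendsto (fun K : ℕ => p (K - 1) * Real.log K) atTop (𝓝 0) := by
  have h1 : Tendsto p atTop (𝓝 0) := by
    refine squeeze_zero hp0 hp ?_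
    have := (tendsto_one_div_add_atTop_nhds_zero_nat (𝕜 := ℝ)).const_mul C
    simpa [div_eq_mul_inv] using this
  refine ⟨h1, h1.comp (tendsto_sub_atTop_nat 1), ?_⟩
  have h2 := tendsto_log_div_natCast.const_mul C
  rw [mul_zero] at h2
  refine squeeze_zero' ?_ ?_ h2
  · filter_upwards [eventually_ge_atTop 1] with K hK
    exact mul_nonneg (hp0 _) (Real.log_nonneg (by exact_mod_cast hK))
  · filter_upwards [eventually_ge_atTop 1] with K hK
    have h3 := mul_le_mul_of_nonneg_right (hp (K - 1))
      (Real.log_nonneg (by exact_mod_cast hK : (1 : ℝ) ≤ K))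
    -- At `n = K - 1` the bound `C / (n + 1)` is exactly `C / K`.
    rw [Nat.cast_sub hK, Nat.cast_one, sub_add_cancel] at h3
    exact h3.trans_eq (by ring)

/-! ### Limits of the two mean logarithms. -/

section Limits

variable {X : Type*} [MeasurableSpace X] {q₀ q₁ : Measure X} {r : X → ℝ}

theorem tendsto_integral_log_one_add_div (hr_meas : Measurable r) (hr_pos : ∀ x, 0 < r x)
    [IsProbabilityMeasure q₁]
    (hlog_int : Integrable (fun x => Real.log (r x)) q₁) {η : ℝ} (hη : 0 < η) :
    Tendsto (fun K : ℕ => ∫ x, Real.log (1 + r x / (K * η)) ∂q₁) atTop (𝓝 0) := by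
  have hlim : Tendsto (fun K : ℕ => ∫ x, Real.log (1 + r x / (K * η)) ∂q₁) atTop
      (𝓝 (∫ _, (0 : ℝ) ∂q₁)) := by
    refine tendsto_integral_filter_of_dominated_convergence
      (fun x => Real.log (1 + r x / η))
      (.of_forall fun K => (Measurable.log (by fun_prop)).aestronglyMeasurable) ?_
      (integrable_log_one_add hr_meas hr_pos hlog_int hη) (ae_of_all _ fun x => ?_)
    · filter_upwards [eventually_ge_atTop 1] with K hK
      have hK' : (1 : ℝ) ≤ K := by exact_mod_cast hK
      refine ae_of_all _ fun x => ?_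
      have hr := hr_pos x
      have h1 : 0 ≤ r x / (K * η) := by positivity
      rw [Real.norm_of_nonneg (Real.log_nonneg (by linarith))]
      refine Real.log_le_log (by linarith) ?_
      gcongr
      exact le_mul_of_one_le_left hη.le hK'
    · have h : Tendsto (fun K : ℕ => Real.log (1 + r x / (K * η))) atTop
          (𝓝 (Real.log (1 + 0))) := by
        refine Tendsto.log (tendsto_const_nhds.add ?_) (by norm_num)
        exact tendsto_const_nhds.div_atTop (tendsto_natCast_atTop_atTop.atTop_mul_const hη)
      simpa using h
  simpa using hlim

variable [IsProbabilityMeasure q₀]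

theorem tendsto_integral_log_mean_prod [IsProbabilityMeasure q₁]
    (hr_meas : Measurable r) (hr_pos : ∀ x, 0 < r x)
    (hr_int : Integrable r q₀) (hlog_int : Integrable (fun x => Real.log (r x)) q₁)
    {ν : ℕ → ℝ} (hν : ∀ K, 0 ≤ ν K) {β : ℝ} (hβ : 0 ≤ β)
    (hlim : Tendsto (fun K : ℕ => ν K / (K : ℝ)) atTop (𝓝 β)) :
    Tendsto (fun K : ℕ => ∫ x : X × (Fin (K - 1) → X),
        Real.log (ν K / K + (r x.1 + ∑ i, r (x.2 i)) / K) ∂(positiveLaw q₀ q₁ K))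
      atTop (𝓝 (Real.log (β + ∫ x, r x ∂q₀))) := by
  set m := ∫ x, r x ∂q₀
  have hm : 0 < m := integral_pos_of_forall_pos hr_pos hr_int
  refine tendsto_order.2 ⟨fun a ha => ?_, fun a ha => ?_⟩
  · have hcont : Tendsto (fun c => Real.log (β + c)) (𝓝[<] m) (𝓝 (Real.log (β + m))) :=
      ((continuous_const.add continuous_id).continuousAt.log
        (add_pos_of_nonneg_of_pos hβ hm).ne').tendsto.mono_left
        nhdsWithin_le_nhds
    -- A level `c` just below `m` leaves room for the weak law while keeping `log (β + c)` above
    -- `a`.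
    obtain ⟨c, hac, hc0, hcm⟩ := ((hcont.eventually_const_lt ha).and
      (Ioo_mem_nhdsLT hm)).exists
    obtain ⟨C, hC⟩ := exists_measureReal_sum_lt_le hr_meas hr_pos hr_int hcm
    obtain ⟨-, hp, hplog⟩ := tendsto_zero_of_le_div_add_one (fun n => measureReal_nonneg) hC
    have hl : Tendsto (fun K : ℕ => Real.log (ν K / K + ((K - 1 : ℕ) : ℝ) / K * c)) atTop
        (𝓝 (Real.log (β + 1 * c))) :=
      (hlim.add (tendsto_natCast_sub_one_div.mul_const c)).log (by positivity)
    have hlow := ((hp.const_sub 1).mul hl).add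
      ((hp.mul_const (∫ x, Real.log (r x) ∂q₁)).sub hplog)
    simp only [sub_zero, one_mul, zero_mul, add_zero] at hlow
    filter_upwards [hlow.eventually_const_lt hac, eventually_gt_atTop 1] with K hK hK1
    refine hK.trans_le (le_trans (le_of_eq ?_) (le_integral_log_mean_prod hr_meas hr_pos hr_int
      hlog_int (Nat.sub_pos_of_lt hK1) (hν K)
      (by exact_mod_cast (zero_lt_one.trans hK1) : (0 : ℝ) < K) hc0))
    ring
  · have hcont : Tendsto (fun η => Real.log (β + m + η)) (𝓝[>] 0) (𝓝 (Real.log (β + m + 0))) :=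
      ((continuous_const.add continuous_id).continuousAt.log
        (by simp; positivity)).tendsto.mono_left nhdsWithin_le_nhds
    rw [add_zero] at hcont
    obtain ⟨η, hηa, hη⟩ := ((hcont.eventually_lt_const ha).and self_mem_nhdsWithin).exists
    have hη : 0 < η := hη
    have hup := (((hlim.add (tendsto_natCast_sub_one_div.mul_const m)).add_const η).log
      (by positivity)).add (tendsto_integral_log_one_add_div hr_meas hr_pos hlog_int hη)
    rw [one_mul, add_zero] at hup
    filter_upwards [hup.eventually_lt_const hηa, eventually_gt_atTop 0] with K hK hK1
    exact (integral_log_mean_prod_le hr_meas hr_pos hr_int hlog_int (K - 1) (hν K)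
      (by exact_mod_cast hK1 : (0 : ℝ) < K) hη).trans_lt hK

/-- The weight `ν_K / K` makes the anchor term converge even when `β = 0`, where the mean of
`log` itself may degenerate. -/
theorem tendsto_mul_integral_log_mean_pi
    (hr_meas : Measurable r) (hr_pos : ∀ x, 0 < r x) (hr_int : Integrable r q₀)
    {ν : ℕ → ℝ} (hν : ∀ K, 0 ≤ ν K) {β : ℝ} (hβ : 0 ≤ β)
    (hlim : Tendsto (fun K : ℕ => ν K / (K : ℝ)) atTop (𝓝 β)) :
    Tendsto (fun K : ℕ => ν K / K * ∫ x : Fin K → X,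
        Real.log (ν K / K + (∑ i, r (x i)) / K) ∂(anchorLaw q₀ K))
      atTop (𝓝 (β * Real.log (β + ∫ x, r x ∂q₀))) := by
  set m := ∫ x, r x ∂q₀
  have hm : 0 < m := integral_pos_of_forall_pos hr_pos hr_int
  refine tendsto_order.2 ⟨fun a ha => ?_, fun a ha => ?_⟩
  · have hcont : Tendsto (fun c => β * Real.log (β + c)) (𝓝[<] m) (𝓝 (β * Real.log (β + m))) :=
      (((continuous_const.add continuous_id).continuousAt.log
        (add_pos_of_nonneg_of_pos hβ hm).ne').tendsto.const_mul β).mono_left nhdsWithin_le_nhds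
    obtain ⟨c, hac, hc0, hcm⟩ := ((hcont.eventually_const_lt ha).and
      (Ioo_mem_nhdsLT hm)).exists
    obtain ⟨C, hC⟩ := exists_measureReal_sum_lt_le hr_meas hr_pos hr_int hcm
    obtain ⟨hp, -, -⟩ := tendsto_zero_of_le_div_add_one (fun n => measureReal_nonneg) hC
    have hl : Tendsto (fun K : ℕ => Real.log (ν K / K + c)) atTop (𝓝 (Real.log (β + c))) :=
      (hlim.add_const c).log (by positivity)
    -- Continuity of `x log x`, including at `0`, keeps the exceptional contribution `p * (ν/K) log
    -- (ν/K)` negligible even when `β = 0`.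
    have hblog := (Real.continuous_mul_log.tendsto β).comp hlim
    have hlow := ((hlim.mul (hp.const_sub 1)).mul hl).add (hp.mul hblog)
    simp only [sub_zero, mul_one, zero_mul, add_zero] at hlow
    filter_upwards [hlow.eventually_const_lt hac, eventually_gt_atTop 0] with K hK hK1
    refine hK.trans_le ?_
    have hK' : (0 : ℝ) < K := by exact_mod_cast hK1
    rcases (hν K).eq_or_lt with h0 | hpos
    · simp [← h0]
    · refine le_trans (le_of_eq ?_) (mul_le_mul_of_nonneg_left
        (le_integral_log_mean_pi hr_meas hr_pos hr_int hK1 hpos hc0) (div_pos hpos hK').le)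
      simp only [Function.comp]
      ring
  · have hup := hlim.mul ((hlim.add_const m).log (by positivity))
    filter_upwards [hup.eventually_lt_const ha, eventually_gt_atTop 0] with K hK hK1
    refine lt_of_le_of_lt ?_ hK
    have hK' : (0 : ℝ) < K := by exact_mod_cast hK1
    rcases (hν K).eq_or_lt with h0 | hpos
    · simp [← h0]
    · exact mul_le_mul_of_nonneg_left
        (integral_log_mean_pi_le hr_meas hr_pos hr_int hK1 hpos) (div_pos hpos hK').le

end Limits

/-! ### Normal form of the loss and its limit. -/

section Loss

variable {X : Type*} [MeasurableSpace X] {q₀ q₁ : Measure X} {r : X → ℝ}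
  [IsProbabilityMeasure q₀]

theorem integrable_logPosterior [IsProbabilityMeasure q₁]
    (hr_meas : Measurable r) (hr_pos : ∀ x, 0 < r x)
    (hr_int : Integrable r q₀) (hlog_int : Integrable (fun x => Real.log (r x)) q₁)
    (K : ℕ) {v : ℝ} (hv : 0 ≤ v) :
    Integrable (logPosterior r K v) (positiveLaw q₀ q₁ K) := by
  refine ((hlog_int.comp_fst _).sub
    (integrable_log_prod hr_meas hr_pos hr_int hlog_int (K - 1) hv)).congr
    (ae_of_all _ fun x => ?_)
  have hT := sum_eval_nonneg hr_pos x.2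
  have hr := hr_pos x.1
  rw [logPosterior, Real.log_div hr.ne' (by positivity)]
  rfl

theorem integrable_logAnchorPosterior (hr_meas : Measurable r) (hr_pos : ∀ x, 0 < r x)
    (hr_int : Integrable r q₀) (K : ℕ) {v : ℝ} (hv : 0 ≤ v) :
    Integrable (logAnchorPosterior r K v) (anchorLaw q₀ K) := by
  -- For `v = 0` the integrand is `Real.log 0 = 0`.
  rcases hv.eq_or_lt with rfl | hpos
  · refine (integrable_zero _ ℝ _).congr (ae_of_all _ fun x => ?_)
    simp [logAnchorPosterior]
  · refine ((integrable_const (Real.log v)).sub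
      (integrable_log_pi hr_meas hr_pos hr_int K hpos)).congr (ae_of_all _ fun x => ?_)
    have hT := sum_eval_nonneg hr_pos x
    rw [logAnchorPosterior, Real.log_div hpos.ne' (by positivity)]
    rfl

theorem integral_logPosterior [IsProbabilityMeasure q₁]
    (hr_meas : Measurable r) (hr_pos : ∀ x, 0 < r x)
    (hr_int : Integrable r q₀) (hlog_int : Integrable (fun x => Real.log (r x)) q₁)
    {K : ℕ} (hK : 0 < K) {v : ℝ} (hv : 0 ≤ v) :
    ∫ x, logPosterior r K v x ∂(positiveLaw q₀ q₁ K)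
      = ∫ x, Real.log (r x) ∂q₁ - Real.log K - ∫ x : X × (Fin (K - 1) → X),
        Real.log (v / K + (r x.1 + ∑ i, r (x.2 i)) / K) ∂(positiveLaw q₀ q₁ K) := by
  have hK' : (0 : ℝ) < K := by exact_mod_cast hK
  have hI1 : Integrable (fun x => Real.log (r x) - Real.log K) q₁ :=
    hlog_int.sub (integrable_const _)
  have h : ∀ x, logPosterior r K v x = (Real.log (r x.1) - Real.log K)
      - Real.log (v / K + (r x.1 + ∑ i, r (x.2 i)) / K) := fun x => by
    have hT := sum_eval_nonneg hr_pos x.2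
    have hr := hr_pos x.1
    rw [logPosterior, Real.log_div hr.ne' (by positivity), log_div_add_div hK' (by positivity)]
    ring
  simp only [h, positiveLaw]
  rw [integral_sub (hI1.comp_fst _)
      (integrable_log_mean_prod hr_meas hr_pos hr_int hlog_int (K - 1) hv hK'),
    integral_fun_fst (fun x => Real.log (r x) - Real.log K),
    integral_sub hlog_int (integrable_const _)]
  simp

theorem integral_logAnchorPosterior (hr_meas : Measurable r) (hr_pos : ∀ x, 0 < r x)
    (hr_int : Integrable r q₀) {K : ℕ} (hK : 0 < K) {v : ℝ} (hv : 0 < v) :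
    ∫ x, logAnchorPosterior r K v x ∂(anchorLaw q₀ K)
      = Real.log (v / K) - ∫ x : Fin K → X,
        Real.log (v / K + (∑ i, r (x i)) / K) ∂(anchorLaw q₀ K) := by
  have hK' : (0 : ℝ) < K := by exact_mod_cast hK
  have h : ∀ x, logAnchorPosterior r K v x = Real.log (v / K)
      - Real.log (v / K + (∑ i, r (x i)) / K) := fun x => by
    have hT := sum_eval_nonneg hr_pos x
    rw [logAnchorPosterior, Real.log_div hv.ne' (by positivity),
      log_div_add_div hK' (by positivity), Real.log_div hv.ne' hK'.ne']
    ring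
  simp only [h, anchorLaw]
  rw [integral_sub (integrable_const _)
    (integrable_log_mean_pi hr_meas hr_pos hr_int K hv hK')]
  simp

/-- Normalizing by `K` leaves `-log K` only in the positive term, where the added `K log K / (K +
v)` cancels it. In the anchor term the numerator is rescaled too, producing `log (v / K)`. -/
theorem neg_loss_add_eq [IsProbabilityMeasure q₁]
    (hr_meas : Measurable r) (hr_pos : ∀ x, 0 < r x)
    (hr_int : Integrable r q₀) (hlog_int : Integrable (fun x => Real.log (r x)) q₁)
    {K : ℕ} (hK : 0 < K) {v : ℝ} (hv : 0 ≤ v) :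
    -loss q₀ q₁ r K v + K * Real.log K / (K + v)
      = ((∫ x, Real.log (r x) ∂q₁ - ∫ x : X × (Fin (K - 1) → X),
            Real.log (v / K + (r x.1 + ∑ i, r (x.2 i)) / K) ∂(positiveLaw q₀ q₁ K))
          + v / K * Real.log (v / K)
          - v / K * ∫ x : Fin K → X,
              Real.log (v / K + (∑ i, r (x i)) / K) ∂(anchorLaw q₀ K)) / (1 + v / K) := by
  have hK' : (0 : ℝ) < K := by exact_mod_cast hK
  rw [loss, integral_logPosterior hr_meas hr_pos hr_int hlog_int hK hv]
  rcases hv.eq_or_lt with rfl | hpos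
  · simp [hK'.ne']
    ring
  · rw [integral_logAnchorPosterior hr_meas hr_pos hr_int hK hpos]
    field_simp
    ring

theorem tendsto_neg_loss [IsProbabilityMeasure q₁]
    (hr_meas : Measurable r) (hr_pos : ∀ x, 0 < r x)
    (hr_int : Integrable r q₀) (hlog_int : Integrable (fun x => Real.log (r x)) q₁)
    {ν : ℕ → ℝ} (hν : ∀ K, 0 ≤ ν K) {β : ℝ} (hβ : 0 ≤ β)
    (hlim : Tendsto (fun K : ℕ => ν K / (K : ℝ)) atTop (𝓝 β)) :
    Tendsto (fun K : ℕ => -loss q₀ q₁ r K (ν K)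
        + (K : ℝ) * Real.log (K : ℝ) / ((K : ℝ) + ν K))
      atTop (𝓝 (limitValue q₀ q₁ r β)) := by
  have hblog := (Real.continuous_mul_log.tendsto β).comp hlim
  have h := ((((tendsto_const_nhds (x := ∫ x, Real.log (r x) ∂q₁)).sub
    (tendsto_integral_log_mean_prod hr_meas hr_pos hr_int hlog_int hν hβ hlim)).add hblog).sub
    (tendsto_mul_integral_log_mean_pi hr_meas hr_pos hr_int hν hβ hlim)).div
    (hlim.const_add 1) (by positivity)
  have hval : limitValue q₀ q₁ r β = (∫ x, Real.log (r x) ∂q₁ - Real.log (β + ∫ x, r x ∂q₀)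
      + β * Real.log β - β * Real.log (β + ∫ x, r x ∂q₀)) / (1 + β) := by
    rw [limitValue]
    field_simp
    ring
  rw [hval]
  refine h.congr' ?_
  filter_upwards [eventually_gt_atTop 0] with K hK
  exact (neg_loss_add_eq hr_meas hr_pos hr_int hlog_int hK (hν K)).symm

end Loss

end InfoNCEAnchor

/-! ### The main theorem. -/

theorem mainTheorem6 {X : Type*} [MeasurableSpace X]
    (q₀ q₁ : Measure X) [IsProbabilityMeasure q₀] [IsProbabilityMeasure q₁]
    (r : X → ℝ) (hr_meas : Measurable r) (hr_pos : ∀ x, 0 < r x)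
    (hr_int : Integrable r q₀) (hlog_int : Integrable (fun x => Real.log (r x)) q₁)
    (ν : ℕ → ℝ) (hν : ∀ K, 0 ≤ ν K) (β : ℝ) (hβ : 0 ≤ β)
    (hlim : Tendsto (fun K : ℕ => ν K / (K : ℝ)) atTop (𝓝 β)) :
    -- the expectations in the objective are finite
    (∀ K : ℕ, 1 ≤ K →
      Integrable (InfoNCEAnchor.logPosterior r K (ν K)) (InfoNCEAnchor.positiveLaw q₀ q₁ K) ∧
      Integrable (InfoNCEAnchor.logAnchorPosterior r K (ν K)) (InfoNCEAnchor.anchorLaw q₀ K)) ∧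
    -- the limit
    Tendsto
      (fun K : ℕ => -InfoNCEAnchor.loss q₀ q₁ r K (ν K)
        + (K : ℝ) * Real.log (K : ℝ) / ((K : ℝ) + ν K))
      atTop (𝓝 (InfoNCEAnchor.limitValue q₀ q₁ r β)) ∧
    -- the bound
    (InfoNCEAnchor.limitValue q₀ q₁ r β : EReal) ≤ InfoNCEAnchor.upperBound q₀ q₁ β ∧
    -- the equality cases, whenever the density ratio of `q₁` to `q₀` exists
    (q₁ ≪ q₀ →
      (0 < β →
        ((InfoNCEAnchor.limitValue q₀ q₁ r β : EReal) = InfoNCEAnchor.upperBound q₀ q₁ β ↔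
          ∀ᵐ x ∂q₀, r x = (q₁.rnDeriv q₀ x).toReal)) ∧
      (β = 0 →
        ((InfoNCEAnchor.limitValue q₀ q₁ r β : EReal) = InfoNCEAnchor.upperBound q₀ q₁ β ↔
          ∃ C : ℝ, 0 < C ∧ ∀ᵐ x ∂q₀, r x = C * (q₁.rnDeriv q₀ x).toReal))) := by
  refine ⟨fun K _ => ⟨InfoNCEAnchor.integrable_logPosterior hr_meas hr_pos hr_int hlog_int K (hν K),
    InfoNCEAnchor.integrable_logAnchorPosterior hr_meas hr_pos hr_int K (hν K)⟩,
    InfoNCEAnchor.tendsto_neg_loss hr_meas hr_pos hr_int hlog_int hν hβ hlim,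
    InfoNCEAnchor.limitValue_le_upperBound hr_pos hr_int hlog_int hβ, fun hac =>
    ⟨fun hβ0 => ⟨fun h => ?_, fun h => ?_⟩, fun hβ0 => ⟨fun h => ?_, ?_⟩⟩⟩
  · obtain ⟨hae, hlog⟩ := InfoNCEAnchor.eq_of_limitValue_eq_upperBound hr_pos hr_int hlog_int hβ h
    have hm := InfoNCEAnchor.eq_one_of_log_div_eq
      (InfoNCEAnchor.integral_pos_of_forall_pos hr_pos hr_int) hβ0 hlog
    simpa only [hm, one_mul] using hae
  · exact InfoNCEAnchor.limitValue_eq_upperBound_of_ae_eq hlog_int hac one_pos (Or.inr rfl)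
      (by simpa only [one_mul] using h)
  · exact ⟨_, InfoNCEAnchor.integral_pos_of_forall_pos hr_pos hr_int,
      (InfoNCEAnchor.eq_of_limitValue_eq_upperBound hr_pos hr_int hlog_int hβ h).1⟩
  · rintro ⟨C, hC, h⟩
    exact InfoNCEAnchor.limitValue_eq_upperBound_of_ae_eq hlog_int hac hC (Or.inl hβ0) h
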